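/- Let $L\ge 2$ be an integer, let $d_0,d_1,\dots,d_L$ be layer widths with $d_i\ge\min\{d_0,d_L\}$ for every $i\in\{0,\dots,L\}$, let $M^\natural\in\mathbb{R}^{d_L\times d_0}$ and let $\lambda>0$. For $\mathbf w=(W_1,\dots,W_L)$ with $W_i\in\mathbb{R}^{d_i\times d_{i-1}}$ put $$\mathcal L(\mathbf w)=\bigl\|M^\natural-W_LW_{L-1}\cdots W_1\bigr\|_F^2+\frac{\lambda}{L}\sum_{i=1}^L\|W_i\|_F^2 ,$$ where $\|\cdot\|_F$ is the Frobenius norm, and let $\Omega$ be the set of global minimizers of $\mathcal L$ over all such $\mathbf w$. Put $q=2/L$ and $$\tau=\Bigl(1-\frac q2\Bigr)\,\lambda^{\frac1{2-q}}\,(1-q)^{\frac{q-1}{2-q}}$$ (for $L=2$ the last factor is $0^0=1$). Let $\sigma_1(M^\natural)\ge\dots\ge\sigma_r(M^\natural)\ge 0$, $r=\min\{d_0,d_L\}$, be the singular values of $M^\natural$. If $\sigma_i(M^\natural)\ne\tau$ for every $i\in\{1,\dots,r\}$, then the function $(\mathbf w,i)\mapsto\|W_i\|_F$ is constant on $\Omega\times\{1,\dots,L\}$;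 that is, there is a constant $c$ such that $\|W_i\|_F=c$ for every global minimizer $\mathbf w=(W_1,\dots,W_L)\in\Omega$ of $\mathcal L$ and every layer $i$. -/

import Mathlib

namespace DeepFactorization

/-- The parameter space of a depth-`L` factorization with layer widths `d 0, …, d L`. The `i`-th
layer (counted from `0`) is a real matrix with `d (i + 1)` rows and `d i` columns. -/
abbrev Params {L : ℕ} (d : Fin (L + 1) → ℕ) : Type :=
  (i : Fin L) → Matrix (Fin (d i.succ)) (Fin (d i.castSucc)) ℝ

/-- The product `W_k ⋯ W_1` of the first `k` layers (the identity for `k = 0`). -/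
noncomputable def partialProd {L : ℕ} {d : Fin (L + 1) → ℕ} (W : Params d) (k : Fin (L + 1)) :
    Matrix (Fin (d k)) (Fin (d 0)) ℝ :=
  Fin.induction (motive := fun k => Matrix (Fin (d k)) (Fin (d 0)) ℝ) 1 (fun i P => W i * P) k

/-- The end-to-end matrix `W_L W_{L-1} ⋯ W_1`. -/
noncomputable def endToEnd {L : ℕ} {d : Fin (L + 1) → ℕ} (W : Params d) :
    Matrix (Fin (d (Fin.last L))) (Fin (d 0)) ℝ :=
  partialProd W (Fin.last L)

section Frobenius

open scoped Matrix.Norms.Frobenius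

/-- The Frobenius norm of a real matrix. -/
noncomputable def frobeniusNorm {m n : ℕ} (A : Matrix (Fin m) (Fin n) ℝ) : ℝ := ‖A‖

end Frobenius

/-- The `ℓ²`-regularized deep matrix factorization loss
`‖M - W_L ⋯ W_1‖_F ^ 2 + (lam / L) * ∑ i, ‖W_i‖_F ^ 2`. -/
noncomputable def loss {L : ℕ} {d : Fin (L + 1) → ℕ}
    (M : Matrix (Fin (d (Fin.last L))) (Fin (d 0)) ℝ) (lam : ℝ) (W : Params d) : ℝ :=
  frobeniusNorm (M - endToEnd W) ^ 2 + lam / (L : ℝ) * ∑ i, frobeniusNorm (W i) ^ 2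

/-- The set of global minimizers of the loss. -/
def minimizers {L : ℕ} {d : Fin (L + 1) → ℕ}
    (M : Matrix (Fin (d (Fin.last L))) (Fin (d 0)) ℝ) (lam : ℝ) : Set (Params d) :=
  {W | ∀ W' : Params d, loss M lam W ≤ loss M lam W'}

/-- The function `g (W, i) = ‖W_i‖_F`. -/
noncomputable def layerNorm {L : ℕ} {d : Fin (L + 1) → ℕ} (W : Params d) (i : Fin L) : ℝ :=
  frobeniusNorm (W i)

/-- The vector of the `min m n` singular values of an `m × n` matrix, in non-increasing order. -/
noncomputable def singularValueVec {m n : ℕ} (A : Matrix (Fin m) (Fin n) ℝ) :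
    Fin (min m n) → ℝ :=
  fun i => (Matrix.toEuclideanLin A).singularValues i

/-- The threshold `(1 - q / 2) * lam ^ (1 / (2 - q)) * (1 - q) ^ ((q - 1) / (2 - q))`
with `q = 2 / L`. For `L = 2` the last factor is `0 ^ 0 = 1`. -/
noncomputable def threshold (L : ℕ) (lam : ℝ) : ℝ :=
  let q : ℝ := 2 / (L : ℝ)
  (1 - q / 2) * lam ^ (1 / (2 - q)) * (1 - q) ^ ((q - 1) / (2 - q))

/-- The `m × n` matrices that have a singular value equal to the threshold. -/
def exceptionalSet (L m n : ℕ) (lam : ℝ) : Set (Matrix (Fin m) (Fin n) ℝ) :=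
  ⋃ i : Fin (min m n), {A | singularValueVec A i = threshold L lam}

end DeepFactorization

namespace DeepFactorization

open Matrix

section Frobenius

open scoped Matrix.Norms.Frobenius

/-! Write `X` for the end-to-end matrix of a minimizer and `c = lam / L`. Stationarity in each layer
expresses `c • W i` through the residual `M - X`, and yields balancedness: the row Gram matrix of
each layer equals the column Gram matrix of the next. Hence all layers have the same squared norm,
the trace of `P = W_1ᵀ W_1`, and it remains to see that this trace depends on `M` alone.

Balancedness telescopes `XᵀX` to `P ^ L`, and eliminating `X` leaves `MᵀM P ^ L = (c P + P ^ L) ^ 2`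
(`gram_mul_balanceMatrix_pow`). The right side is symmetric, so `MᵀM` commutes with `P ^ L` and
therefore with `P`. In a common eigenbasis, with eigenvalues `s_j ^ 2` and `t_j ^ 2`, the loss
splits into scalar losses in the pairs `(s_j, t_j)`.

The width condition leaves room for competitors with arbitrary `t_j` along the singular directions
with `s_j ≠ 0`, so each `t_j` minimizes its scalar loss (`isScalarOptimum_of_minimizer`). That
minimizer is unique unless `s_j` is the threshold, where zero can tie with a positive value
(`IsScalarOptimum.unique`). Thus `t_j` is a function of `s_j`, and `∑ t_j ^ 2` a function of the
spectrum of `MᵀM`. -/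

theorem frobeniusNorm_nonneg {m n : ℕ} (A : Matrix (Fin m) (Fin n) ℝ) : 0 ≤ frobeniusNorm A :=
  norm_nonneg A

theorem frobeniusNorm_sq {m n : ℕ} (A : Matrix (Fin m) (Fin n) ℝ) :
    frobeniusNorm A ^ 2 = (Aᵀ * A).trace := by
  have h : (0 : ℝ) ≤ ∑ i, ∑ j, ‖A i j‖ ^ (2 : ℝ) :=
    Finset.sum_nonneg fun i _ => Finset.sum_nonneg fun j _ => by positivity
  rw [frobeniusNorm, frobenius_norm_def, ← Real.sqrt_eq_rpow, Real.sq_sqrt h, Finset.sum_comm]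
  simp [Matrix.trace, Matrix.mul_apply, sq]

end Frobenius

theorem eq_zero_of_trace_transpose_mul_self {m n : ℕ} {A : Matrix (Fin m) (Fin n) ℝ}
    (h : (Aᵀ * A).trace = 0) : A = 0 := by
  rwa [← conjTranspose_eq_transpose_of_trivial, trace_conjTranspose_mul_self_eq_zero_iff] at h

theorem trace_transpose_mul_comm {m n : ℕ} (A B : Matrix (Fin m) (Fin n) ℝ) :
    (Aᵀ * B).trace = (Bᵀ * A).trace := by
  rw [← trace_transpose, transpose_mul, transpose_transpose]

/-! ### Prefix and suffix products of layers -/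

section Products

variable {L : ℕ} {d : Fin (L + 1) → ℕ}

theorem partialProd_zero (W : Params d) : partialProd W 0 = 1 := rfl

theorem partialProd_succ (W : Params d) (i : Fin L) :
    partialProd W i.succ = W i * partialProd W i.castSucc := rfl

/-- The product `W_L ⋯ W_{k+1}` of the layers after the first `k`. -/
noncomputable def suffixProd (W : Params d) (k : Fin (L + 1)) :
    Matrix (Fin (d (Fin.last L))) (Fin (d k)) ℝ :=
  Fin.reverseInduction (motive := fun k => Matrix (Fin (d (Fin.last L))) (Fin (d k)) ℝ) 1
    (fun i A => A * W i) k

theorem suffixProd_last (W : Params d) : suffixProd W (Fin.last L) = 1 := by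
  simp [suffixProd]

theorem suffixProd_castSucc (W : Params d) (i : Fin L) :
    suffixProd W i.castSucc = suffixProd W i.succ * W i := by
  simp [suffixProd]

theorem suffixProd_mul_partialProd (W : Params d) (k : Fin (L + 1)) :
    suffixProd W k * partialProd W k = endToEnd W := by
  induction k using Fin.reverseInduction with
  | last => rw [suffixProd_last, Matrix.one_mul, endToEnd]
  | cast i ih => rw [← ih, suffixProd_castSucc, partialProd_succ, Matrix.mul_assoc]

theorem suffixProd_zero (W : Params d) : suffixProd W 0 = endToEnd W := by
  rw [← suffixProd_mul_partialProd W 0, partialProd_zero, Matrix.mul_one]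

theorem partialProd_congr {W W' : Params d} (k : Fin (L + 1))
    (h : ∀ i : Fin L, i.castSucc < k → W i = W' i) : partialProd W k = partialProd W' k := by
  induction k using Fin.induction with
  | zero => rfl
  | succ i ih =>
    rw [partialProd_succ, partialProd_succ, h i Fin.castSucc_lt_succ,
      ih fun j hj => h j (hj.trans Fin.castSucc_lt_succ)]

theorem suffixProd_congr {W W' : Params d} (k : Fin (L + 1))
    (h : ∀ i : Fin L, k ≤ i.castSucc → W i = W' i) : suffixProd W k = suffixProd W' k := by
  induction k using Fin.reverseInduction with
  | last => rw [suffixProd_last, suffixProd_last]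
  | cast i ih =>
    rw [suffixProd_castSucc, suffixProd_castSucc, h i le_rfl,
      ih fun j hj => h j (Fin.castSucc_lt_succ.le.trans hj)]

theorem endToEnd_update (W : Params d) (i : Fin L) (V : Matrix (Fin (d i.succ)) (Fin (d i.castSucc)) ℝ) :
    endToEnd (Function.update W i V) = suffixProd W i.succ * V * partialProd W i.castSucc := by
  rw [← suffixProd_mul_partialProd _ i.succ, partialProd_succ, Function.update_self,
    suffixProd_congr (W' := W), partialProd_congr (W' := W), Matrix.mul_assoc]
  · intro j hj
    exact Function.update_of_ne (by rintro rfl; exact lt_irrefl _ hj) _ _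
  · intro j hj
    exact Function.update_of_ne (by rintro rfl; exact absurd hj (not_le.2 Fin.castSucc_lt_succ)) _ _

end Products

theorem linear_coeff_eq_zero {a b : ℝ} (h : ∀ x : ℝ, 0 ≤ a * x + b * x ^ 2) : a = 0 := by
  by_contra ha
  have hb : 0 < |b| + 1 := by positivity
  -- This point opposes the sign of `a`, and the denominator exceeds `b`, so the linear term
  -- dominates.
  have h1 := h (-a / (|b| + 1))
  have h2 : a * (-a / (|b| + 1)) + b * (-a / (|b| + 1)) ^ 2
      = -(a ^ 2 * (|b| + 1 - b)) / (|b| + 1) ^ 2 := by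
    field_simp
    ring
  rw [h2] at h1
  have h3 : 0 < a ^ 2 * (|b| + 1 - b) := by
    have := le_abs_self b
    have : 0 < |b| + 1 - b := by linarith
    positivity
  have : -(a ^ 2 * (|b| + 1 - b)) / (|b| + 1) ^ 2 < 0 := div_neg_of_neg_of_pos (by linarith) (by positivity)
  linarith

/-! ### First-order conditions and balancedness -/

section Stationarity

variable {L : ℕ} {d : Fin (L + 1) → ℕ} {M : Matrix (Fin (d (Fin.last L))) (Fin (d 0)) ℝ} {lam : ℝ}
  {W : Params d}

theorem frobeniusNorm_add_smul_sq {m n : ℕ} (A B : Matrix (Fin m) (Fin n) ℝ) (x : ℝ) :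
    frobeniusNorm (A + x • B) ^ 2
      = frobeniusNorm A ^ 2 + 2 * x * (Aᵀ * B).trace + x ^ 2 * frobeniusNorm B ^ 2 := by
  simp only [frobeniusNorm_sq, transpose_add, transpose_smul, Matrix.add_mul, Matrix.mul_add,
    Matrix.smul_mul, Matrix.mul_smul, trace_add, trace_smul, smul_eq_mul]
  rw [trace_transpose_mul_comm B A]
  ring

theorem loss_update_add_smul (W : Params d) (i : Fin L)
    (H : Matrix (Fin (d i.succ)) (Fin (d i.castSucc)) ℝ) (x : ℝ) :
    loss M lam (Function.update W i (W i + x • H)) = loss M lam W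
      + 2 * (lam / L * ((W i)ᵀ * H).trace - ((M - endToEnd W)ᵀ *
        (suffixProd W i.succ * H * partialProd W i.castSucc)).trace) * x
      + (frobeniusNorm (suffixProd W i.succ * H * partialProd W i.castSucc) ^ 2
        + lam / L * frobeniusNorm H ^ 2) * x ^ 2 := by
  have h1 : M - endToEnd (Function.update W i (W i + x • H)) = (M - endToEnd W)
      + (-x) • (suffixProd W i.succ * H * partialProd W i.castSucc) := by
    rw [endToEnd_update, ← suffixProd_mul_partialProd W i.succ, partialProd_succ]
    simp only [Matrix.mul_add, Matrix.add_mul, Matrix.mul_smul, Matrix.smul_mul, neg_smul,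
      Matrix.mul_assoc]
    abel
  have h2 : ∑ j, frobeniusNorm (Function.update W i (W i + x • H) j) ^ 2
      = ∑ j, frobeniusNorm (W j) ^ 2 + (2 * x * ((W i)ᵀ * H).trace + x ^ 2 * frobeniusNorm H ^ 2) := by
    rw [← Finset.add_sum_erase _ _ (Finset.mem_univ i),
      ← Finset.add_sum_erase _ (fun j => frobeniusNorm (W j) ^ 2) (Finset.mem_univ i),
      Function.update_self, frobeniusNorm_add_smul_sq]
    rw [Finset.sum_congr rfl (g := fun j => frobeniusNorm (W j) ^ 2)]
    · ring
    · intro j hj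
      rw [Function.update_of_ne (Finset.ne_of_mem_erase hj)]
  rw [loss, loss, h1, h2, frobeniusNorm_add_smul_sq]
  ring

/-- First-order optimality of a global minimizer with respect to one layer. -/
theorem stationarity (hW : W ∈ minimizers M lam) (i : Fin L) :
    (lam / L) • W i
      = (suffixProd W i.succ)ᵀ * (M - endToEnd W) * (partialProd W i.castSucc)ᵀ := by
  set A := suffixProd W i.succ
  set B := partialProd W i.castSucc
  set E := M - endToEnd W
  have key : ∀ H : Matrix (Fin (d i.succ)) (Fin (d i.castSucc)) ℝ,
      (((lam / L) • W i - Aᵀ * E * Bᵀ)ᵀ * H).trace = 0 := by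
    intro H
    have h := linear_coeff_eq_zero
      (a := 2 * (lam / L * ((W i)ᵀ * H).trace - (Eᵀ * (A * H * B)).trace))
      (b := frobeniusNorm (A * H * B) ^ 2 + lam / L * frobeniusNorm H ^ 2) (by
        intro x
        have h := hW (Function.update W i (W i + x • H))
        rw [loss_update_add_smul] at h
        linarith)
    have h3 : (Eᵀ * (A * H * B)).trace = ((Aᵀ * E * Bᵀ)ᵀ * H).trace := by
      simp only [transpose_mul, transpose_transpose]
      rw [← Matrix.mul_assoc, trace_mul_comm]
      simp only [Matrix.mul_assoc]
    rw [transpose_sub, Matrix.sub_mul, trace_sub, transpose_smul, Matrix.smul_mul, trace_smul,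
      smul_eq_mul, ← h3]
    linarith
  exact sub_eq_zero.1 (eq_zero_of_trace_transpose_mul_self (key _))

/-- The matrix `(L / lam) (W_L ⋯ W_{k+1})ᵀ (M - X) (W_k ⋯ W_1)ᵀ`, which at a global minimizer is
the Gram matrix of the two layers adjacent to the `k`-th hidden space. -/
noncomputable def balanceMatrix (M : Matrix (Fin (d (Fin.last L))) (Fin (d 0)) ℝ) (lam : ℝ)
    (W : Params d) (k : Fin (L + 1)) : Matrix (Fin (d k)) (Fin (d k)) ℝ :=
  (lam / L)⁻¹ • ((suffixProd W k)ᵀ * (M - endToEnd W) * (partialProd W k)ᵀ)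

/-- Multiplying stationarity on the left by `(W i)ᵀ` absorbs the layer into the suffix product. The
companion lemma absorbs it into the prefix product; together they make adjacent Gram matrices agree.
-/
theorem transpose_mul_self_eq_balanceMatrix (hc : lam / L ≠ 0) (hW : W ∈ minimizers M lam)
    (i : Fin L) : (W i)ᵀ * W i = balanceMatrix M lam W i.castSucc := by
  rw [balanceMatrix, suffixProd_castSucc, transpose_mul, eq_inv_smul_iff₀ hc, ← Matrix.mul_smul,
    stationarity hW]
  simp only [Matrix.mul_assoc]

theorem mul_transpose_self_eq_balanceMatrix (hc : lam / L ≠ 0) (hW : W ∈ minimizers M lam)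
    (i : Fin L) : W i * (W i)ᵀ = balanceMatrix M lam W i.succ := by
  rw [balanceMatrix, partialProd_succ, transpose_mul, eq_inv_smul_iff₀ hc, ← Matrix.smul_mul,
    stationarity hW]
  simp only [Matrix.mul_assoc]

theorem balanceMatrix_mul_partialProd (hc : lam / L ≠ 0) (hW : W ∈ minimizers M lam)
    (k : Fin (L + 1)) :
    balanceMatrix M lam W k * partialProd W k = partialProd W k * balanceMatrix M lam W 0 := by
  induction k using Fin.induction with
  | zero => rw [partialProd_zero, Matrix.mul_one, Matrix.one_mul]
  | succ i ih =>
    rw [← mul_transpose_self_eq_balanceMatrix hc hW, partialProd_succ, Matrix.mul_assoc (W i),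
      ← Matrix.mul_assoc (W i)ᵀ, transpose_mul_self_eq_balanceMatrix hc hW, ih, Matrix.mul_assoc]

/-- The innermost Gram matrix can be pushed through the prefix product, where it becomes one more
factor of the balance matrix at `0`. -/
theorem partialProd_transpose_mul_self (hc : lam / L ≠ 0) (hW : W ∈ minimizers M lam)
    (k : Fin (L + 1)) :
    (partialProd W k)ᵀ * partialProd W k = balanceMatrix M lam W 0 ^ (k : ℕ) := by
  induction k using Fin.induction with
  | zero => simp [partialProd_zero]
  | succ i ih =>
    rw [partialProd_succ, transpose_mul, Matrix.mul_assoc, ← Matrix.mul_assoc (W i)ᵀ,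
      transpose_mul_self_eq_balanceMatrix hc hW, balanceMatrix_mul_partialProd hc hW,
      ← Matrix.mul_assoc, ih, Fin.val_succ, pow_succ, Fin.val_castSucc]

theorem trace_balanceMatrix (hc : lam / L ≠ 0) (hW : W ∈ minimizers M lam) (k : Fin (L + 1)) :
    (balanceMatrix M lam W k).trace = (balanceMatrix M lam W 0).trace := by
  induction k using Fin.induction with
  | zero => rfl
  | succ i ih =>
    rw [← ih, ← mul_transpose_self_eq_balanceMatrix hc hW,
      ← transpose_mul_self_eq_balanceMatrix hc hW, trace_mul_comm]

theorem frobeniusNorm_layer_sq (hc : lam / L ≠ 0) (hW : W ∈ minimizers M lam) (i : Fin L) :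
    frobeniusNorm (W i) ^ 2 = (balanceMatrix M lam W 0).trace := by
  rw [frobeniusNorm_sq, transpose_mul_self_eq_balanceMatrix hc hW, trace_balanceMatrix hc hW]

theorem endToEnd_transpose_mul_residual (hc : lam / L ≠ 0) :
    (endToEnd W)ᵀ * (M - endToEnd W) = (lam / L) • balanceMatrix M lam W 0 := by
  rw [balanceMatrix, smul_inv_smul₀ hc, suffixProd_zero, partialProd_zero, transpose_one,
    Matrix.mul_one]

theorem residual_mul_endToEnd_transpose (hc : lam / L ≠ 0) :
    (M - endToEnd W) * (endToEnd W)ᵀ = (lam / L) • balanceMatrix M lam W (Fin.last L) := by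
  rw [balanceMatrix, smul_inv_smul₀ hc, suffixProd_last, transpose_one, Matrix.one_mul, endToEnd]

theorem endToEnd_transpose_mul_target (hc : lam / L ≠ 0) (hW : W ∈ minimizers M lam) :
    (endToEnd W)ᵀ * M = (lam / L) • balanceMatrix M lam W 0 + balanceMatrix M lam W 0 ^ L := by
  have h := partialProd_transpose_mul_self hc hW (Fin.last L)
  rw [Fin.val_last] at h
  rw [← endToEnd_transpose_mul_residual hc, ← h, Matrix.mul_sub]
  exact (sub_add_cancel _ _).symm

theorem balanceMatrix_posSemidef (hc : lam / L ≠ 0) (hW : W ∈ minimizers M lam)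
    (hL : 0 < L) : (balanceMatrix M lam W 0).PosSemidef := by
  obtain ⟨L, rfl⟩ := Nat.exists_eq_succ_of_ne_zero hL.ne'
  have h : (W 0)ᵀ * W 0 = balanceMatrix M lam W 0 := transpose_mul_self_eq_balanceMatrix hc hW 0
  rw [← h]
  exact posSemidef_conjTranspose_mul_self (W 0)

theorem balanceMatrix_transpose (hc : lam / L ≠ 0) (hW : W ∈ minimizers M lam)
    (hL : 0 < L) : (balanceMatrix M lam W 0)ᵀ = balanceMatrix M lam W 0 := by
  rw [← conjTranspose_eq_transpose_of_trivial]
  exact (balanceMatrix_posSemidef hc hW hL).isHermitian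

theorem gram_mul_balanceMatrix_pow (hc : lam / L ≠ 0) (hW : W ∈ minimizers M lam) (hL : 0 < L) :
    Mᵀ * M * balanceMatrix M lam W 0 ^ L
      = ((lam / L) • balanceMatrix M lam W 0 + balanceMatrix M lam W 0 ^ L) ^ 2 := by
  set P := balanceMatrix M lam W 0 with hP
  set X := endToEnd W with hX
  have hPt : Pᵀ = P := balanceMatrix_transpose hc hW hL
  have h1 : Xᵀ * X = P ^ L := partialProd_transpose_mul_self hc hW (Fin.last L)
  have h2 : Mᵀ * X = (lam / L) • P + P ^ L := by
    rw [← transpose_transpose (Mᵀ * X), transpose_mul, transpose_transpose,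
      endToEnd_transpose_mul_target hc hW, transpose_add, transpose_smul, transpose_pow, hPt]
  -- The residual times `Xᵀ` is a multiple of the balance matrix at the output, which `X`
  -- intertwines with `P`.
  have h3 : M * Xᵀ * X = X * ((lam / L) • P + P ^ L) := by
    have h4 : M * Xᵀ = (lam / L) • balanceMatrix M lam W (Fin.last L) + X * Xᵀ := by
      rw [← residual_mul_endToEnd_transpose hc, Matrix.sub_mul, ← hX, sub_add_cancel]
    have h5 : balanceMatrix M lam W (Fin.last L) * X = X * P :=
      balanceMatrix_mul_partialProd hc hW (Fin.last L)
    rw [h4, Matrix.add_mul, Matrix.smul_mul, h5, Matrix.mul_assoc X, h1, Matrix.mul_add,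
      Matrix.mul_smul]
  calc Mᵀ * M * P ^ L = Mᵀ * (M * Xᵀ * X) := by rw [← h1]; simp only [Matrix.mul_assoc]
    _ = _ := by rw [h3, ← Matrix.mul_assoc, h2, sq]

theorem loss_minimizer (hc : lam / L ≠ 0) (hW : W ∈ minimizers M lam) (hL : 0 < L) :
    loss M lam W = (Mᵀ * M).trace
      - 2 * ((lam / L) • balanceMatrix M lam W 0 + balanceMatrix M lam W 0 ^ L).trace
      + (balanceMatrix M lam W 0 ^ L).trace + lam * (balanceMatrix M lam W 0).trace := by
  have h1 : (endToEnd W)ᵀ * endToEnd W = balanceMatrix M lam W 0 ^ L :=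
    partialProd_transpose_mul_self hc hW (Fin.last L)
  have h2 := frobeniusNorm_add_smul_sq M (endToEnd W) (-1)
  have hL' : (L : ℝ) ≠ 0 := by positivity
  rw [neg_one_smul, ← sub_eq_add_neg] at h2
  rw [loss, h2, frobeniusNorm_sq, frobeniusNorm_sq, h1,
    trace_transpose_mul_comm M (endToEnd W), endToEnd_transpose_mul_target hc hW]
  simp only [frobeniusNorm_layer_sq hc hW, Finset.sum_const, Finset.card_univ, Fintype.card_fin,
    nsmul_eq_mul]
  field_simp
  ring

end Stationarity

/-! ### The scalar problem and its threshold -/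

/-- The loss contributed by a singular value `s` of the target that is fitted by `t ^ L`, up to the
constant `s ^ 2`. -/
def scalarLoss (L : ℕ) (lam s t : ℝ) : ℝ := -2 * s * t ^ L + t ^ (2 * L) + lam * t ^ 2

theorem scalarLoss_zero {L : ℕ} (hL : L ≠ 0) (lam s : ℝ) : scalarLoss L lam s 0 = 0 := by
  simp [scalarLoss, hL]

/-- A nonnegative stationary point of the scalar loss at which the loss is minimal. -/
structure IsScalarOptimum (L : ℕ) (lam s t : ℝ) : Prop where
  nonneg : 0 ≤ t
  stationary : s * t ^ L = lam / L * t ^ 2 + t ^ (2 * L)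
  le : ∀ t', 0 ≤ t' → scalarLoss L lam s t ≤ scalarLoss L lam s t'

/-- A tie with zero means that the loss at `t` vanishes. With stationarity this fixes `t ^ (2 * n +
2)` and `s * t ^ n`, hence `s`; for `n = 0` it would force `t = 0`. -/
theorem IsScalarOptimum.eq_threshold {n : ℕ} {lam s t : ℝ} (hlam : 0 < lam)
    (h0 : IsScalarOptimum (n + 2) lam s 0) (h : IsScalarOptimum (n + 2) lam s t) (ht : 0 < t) :
    s = threshold (n + 2) lam := by
  have hL : ((n + 2 : ℕ) : ℝ) = n + 2 := by push_cast; ring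
  have h1 : scalarLoss (n + 2) lam s t = 0 := by
    rw [← scalarLoss_zero (L := n + 2) (by omega) lam s]
    exact le_antisymm (h.le 0 le_rfl) (h0.le t h.nonneg)
  have h2 : s * t ^ n = lam / (n + 2) + t ^ (2 * n + 2) := by
    have := h.stationary
    rw [hL] at this
    have ht2 : t ^ 2 ≠ 0 := by positivity
    apply mul_right_cancel₀ ht2
    linear_combination this
  have h3 : t ^ (2 * n + 2) = lam * (1 - 2 / (n + 2)) := by
    have ht2 : t ^ 2 ≠ 0 := by positivity
    apply mul_right_cancel₀ ht2
    rw [scalarLoss] at h1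
    linear_combination (-1) * h1 - 2 * t ^ 2 * h2
  have hn : n ≠ 0 := by
    rintro rfl
    have : 0 < t ^ (2 * 0 + 2) := by positivity
    rw [h3] at this
    norm_num at this
  have hn' : (0 : ℝ) < n := by positivity
  have hq : (1 : ℝ) - 2 / (n + 2) = n / (n + 2) := by field_simp; ring
  have ha : 0 < lam * (n / (n + 2) : ℝ) := by positivity
  have h4 : t = (lam * (n / (n + 2))) ^ (1 / (2 * n + 2) : ℝ) := by
    rw [← hq, ← h3, ← Real.rpow_natCast, ← Real.rpow_mul ht.le]
    push_cast
    rw [mul_one_div_cancel (by positivity), Real.rpow_one]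
  have h5 : t ^ n = (lam * (n / (n + 2))) ^ (n / (2 * n + 2) : ℝ) := by
    rw [h4, ← Real.rpow_natCast, ← Real.rpow_mul ha.le]
    congr 1
    field_simp
  have h6 : s * t ^ n = lam * (1 - 1 / (n + 2)) := by
    rw [h2, h3]
    field_simp
    ring
  have h7 : threshold (n + 2) lam * t ^ n = lam * (1 - 1 / (n + 2)) := by
    simp only [threshold]
    rw [h5, hL, hq, Real.mul_rpow hlam.le (by positivity)]
    have e1 : (1 : ℝ) / (2 - 2 / (n + 2)) = 1 - n / (2 * n + 2) := by
      have : (2 : ℝ) - 2 / (n + 2) = (2 * n + 2) / (n + 2) := by field_simp; ring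
      rw [this]; field_simp; ring
    have e2 : ((2 : ℝ) / (n + 2) - 1) / (2 - 2 / (n + 2)) = -(n / (2 * n + 2)) := by
      have : (2 : ℝ) - 2 / (n + 2) = (2 * n + 2) / (n + 2) := by field_simp; ring
      rw [this]; field_simp; ring
    have hx : (0 : ℝ) < n / (n + 2) := by positivity
    rw [e1, e2, Real.rpow_sub hlam, Real.rpow_neg hx.le, Real.rpow_one]
    have p1 : (0 : ℝ) < lam ^ (n / (2 * n + 2) : ℝ) := by positivity
    have p2 : (0 : ℝ) < (n / (n + 2) : ℝ) ^ (n / (2 * n + 2) : ℝ) := by positivity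
    generalize lam ^ (n / (2 * n + 2) : ℝ) = u at *
    generalize (n / (n + 2) : ℝ) ^ (n / (2 * n + 2) : ℝ) = v at *
    field_simp
  exact mul_right_cancel₀ (pow_ne_zero n ht.ne') (h6.trans h7.symm)

/-- Eliminating `s` from the two stationarity equations gives `h8`. Optimality of `a` against zero
bounds `a ^ (2 * n + 2)` below by `lam * n / (n + 2)`, which makes the left side of `h8` too large
when `a < b`. -/
theorem IsScalarOptimum.not_lt {n : ℕ} {lam s a b : ℝ} (hlam : 0 < lam)
    (h : IsScalarOptimum (n + 2) lam s a) (h' : IsScalarOptimum (n + 2) lam s b) (ha : 0 < a) :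
    ¬ a < b := by
  intro hab
  have hL : ((n + 2 : ℕ) : ℝ) = n + 2 := by push_cast; ring
  have hb : 0 < b := ha.trans hab
  have stat : ∀ t, 0 < t → IsScalarOptimum (n + 2) lam s t →
      s * t ^ n = lam / (n + 2) + t ^ (2 * n + 2) := by
    intro t ht h
    have := h.stationary
    rw [hL] at this
    have ht2 : t ^ 2 ≠ 0 := by positivity
    apply mul_right_cancel₀ ht2
    linear_combination this
  have h1 := stat a ha h
  have h2 := stat b hb h'
  have h3 : lam * n ≤ a ^ (2 * n + 2) * (n + 2) := by
    have h4 := h.le 0 le_rfl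
    rw [scalarLoss_zero (by omega), scalarLoss] at h4
    have h5 : a ^ 2 * (lam - 2 * (lam / (n + 2)) - a ^ (2 * n + 2)) ≤ 0 := by
      have : -2 * s * a ^ (n + 2) + a ^ (2 * (n + 2)) + lam * a ^ 2
        = a ^ 2 * (lam - 2 * (s * a ^ n) + a ^ (2 * n + 2)) := by ring
      rw [this, h1] at h4
      linarith
    have h6 : lam - 2 * (lam / (n + 2)) - a ^ (2 * n + 2) ≤ 0 :=
      nonpos_of_mul_nonpos_right h5 (by positivity)
    have h7 : lam - 2 * (lam / (n + 2)) = lam * n / (n + 2) := by field_simp; ring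
    rw [h7, sub_nonpos, div_le_iff₀ (by positivity)] at h6
    exact h6
  have h8 : a ^ n * b ^ n * (b ^ (n + 2) - a ^ (n + 2)) = lam / (n + 2) * (b ^ n - a ^ n) := by
    linear_combination a ^ n * h2 * (-1) + b ^ n * h1
  have hpow : a ^ n ≤ b ^ n := pow_le_pow_left₀ ha.le hab.le n
  have hpow2 : a ^ (n + 2) < b ^ (n + 2) := pow_lt_pow_left₀ hab ha.le (by omega)
  rcases Nat.eq_zero_or_pos n with rfl | hn
  · simp only [pow_zero, sub_self, mul_zero, one_mul] at h8
    linarith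
  have hn' : (1 : ℝ) ≤ n := by exact_mod_cast hn
  have hlt : a ^ n < b ^ n := pow_lt_pow_left₀ hab ha.le hn.ne'
  have h9 : lam / (n + 2) ≤ a ^ (2 * n + 2) := by
    rw [div_le_iff₀ (by positivity)]
    nlinarith
  have h10 : b ^ 2 * (b ^ n - a ^ n) ≤ b ^ (n + 2) - a ^ (n + 2) := by
    have : a ^ n * a ^ 2 ≤ a ^ n * b ^ 2 := by gcongr
    rw [pow_add, pow_add]; linarith
  have h11 : a ^ n * b ^ n * (b ^ 2 * (b ^ n - a ^ n)) ≤ a ^ (2 * n + 2) * (b ^ n - a ^ n) := by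
    calc _ ≤ a ^ n * b ^ n * (b ^ (n + 2) - a ^ (n + 2)) := by gcongr
      _ = _ := h8
      _ ≤ _ := by
        have : 0 ≤ b ^ n - a ^ n := by linarith
        gcongr
  have h12 : a ^ (2 * n + 2) < a ^ n * b ^ (n + 2) := by
    have : a ^ (2 * n + 2) = a ^ n * a ^ (n + 2) := by ring
    rw [this]
    gcongr
  have h13 : 0 < b ^ n - a ^ n := by linarith
  have := mul_lt_mul_of_pos_right h12 h13
  have e : a ^ n * b ^ n * (b ^ 2 * (b ^ n - a ^ n)) = a ^ n * b ^ (n + 2) * (b ^ n - a ^ n) := by ring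
  linarith

/-- Away from the threshold the scalar problem has at most one optimum. -/
theorem IsScalarOptimum.unique {L : ℕ} (hL : 2 ≤ L) {lam s a b : ℝ} (hlam : 0 < lam)
    (hs : s ≠ threshold L lam) (h : IsScalarOptimum L lam s a) (h' : IsScalarOptimum L lam s b) :
    a = b := by
  obtain ⟨n, rfl⟩ := Nat.exists_eq_add_of_le' hL
  rcases h.nonneg.eq_or_lt with rfl | ha
  · rcases h'.nonneg.eq_or_lt with rfl | hb
    · rfl
    · exact absurd (h.eq_threshold hlam h' hb) hs
  · rcases h'.nonneg.eq_or_lt with rfl | hb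
    · exact absurd (h'.eq_threshold hlam h ha) hs
    · exact le_antisymm (le_of_not_gt (h'.not_lt hlam h hb)) (le_of_not_gt (h.not_lt hlam h' ha))

/-! ### Competitors with prescribed singular values -/

section Competitor

variable {L : ℕ} {d : Fin (L + 1) → ℕ} {J : Type*} [Fintype J] [DecidableEq J]
  {U : (k : Fin (L + 1)) → Matrix (Fin (d k)) J ℝ}

/-- The factorization with layers `U_{i+1} diag(t) U_iᵀ`. -/
noncomputable def diagonalParams (U : (k : Fin (L + 1)) → Matrix (Fin (d k)) J ℝ) (t : J → ℝ) :
    Params d :=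
  fun i => U i.succ * diagonal t * (U i.castSucc)ᵀ

theorem frobeniusNorm_isometry_conj_sq {m n : ℕ} {A : Matrix (Fin m) J ℝ} {B : Matrix (Fin n) J ℝ}
    (hA : Aᵀ * A = 1) (hB : Bᵀ * B = 1) (t : J → ℝ) :
    frobeniusNorm (A * diagonal t * Bᵀ) ^ 2 = ∑ j, t j ^ 2 := by
  rw [frobeniusNorm_sq]
  have : (A * diagonal t * Bᵀ)ᵀ * (A * diagonal t * Bᵀ)
      = B * (diagonal t * (Aᵀ * A) * diagonal t * Bᵀ) := by
    simp only [transpose_mul, transpose_transpose, diagonal_transpose, Matrix.mul_assoc]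
  rw [this, trace_mul_comm, Matrix.mul_assoc, hB, hA, Matrix.mul_one, Matrix.mul_one,
    diagonal_mul_diagonal, trace_diagonal]
  simp only [sq]

theorem transpose_mul_partialProd_diagonalParams (hU : ∀ k, (U k)ᵀ * U k = 1) (t : J → ℝ)
    (k : Fin (L + 1)) :
    (U k)ᵀ * partialProd (diagonalParams U t) k = diagonal t ^ (k : ℕ) * (U 0)ᵀ := by
  induction k using Fin.induction with
  | zero => simp [partialProd_zero]
  | succ i ih =>
    rw [partialProd_succ, diagonalParams, ← Matrix.mul_assoc, ← Matrix.mul_assoc,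
      ← Matrix.mul_assoc, hU, Matrix.one_mul, Matrix.mul_assoc, ih, ← Matrix.mul_assoc,
      Fin.val_succ, pow_succ', Fin.val_castSucc]

theorem endToEnd_diagonalParams (hL : L ≠ 0) (hU : ∀ k, (U k)ᵀ * U k = 1) (t : J → ℝ) :
    endToEnd (diagonalParams U t)
      = U (Fin.last L) * diagonal (fun j => t j ^ L) * (U 0)ᵀ := by
  obtain ⟨n, rfl⟩ := Nat.exists_eq_succ_of_ne_zero hL
  have h : endToEnd (diagonalParams U t) = U (Fin.last n).succ * diagonal t *
      (U (Fin.last n).castSucc)ᵀ * partialProd (diagonalParams U t) (Fin.last n).castSucc := rfl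
  have h2 : diagonal (fun j => t j ^ (n + 1)) = diagonal t ^ (n + 1) := by
    rw [diagonal_pow]; rfl
  rw [h, Matrix.mul_assoc _ (U (Fin.last n).castSucc)ᵀ,
    transpose_mul_partialProd_diagonalParams hU, Fin.val_castSucc, Fin.val_last, h2, pow_succ']
  simp only [Matrix.mul_assoc]
  rfl

theorem loss_diagonalParams (hL : L ≠ 0) (hU : ∀ k, (U k)ᵀ * U k = 1)
    {M : Matrix (Fin (d (Fin.last L))) (Fin (d 0)) ℝ} {s : J → ℝ}
    (hM : (U (Fin.last L))ᵀ * M * U 0 = diagonal s) (lam : ℝ) (t : J → ℝ) :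
    loss M lam (diagonalParams U t)
      = (Mᵀ * M).trace + ∑ j, scalarLoss L lam (s j) (t j) := by
  have h2 := frobeniusNorm_add_smul_sq M (endToEnd (diagonalParams U t)) (-1)
  have hL' : (L : ℝ) ≠ 0 := by positivity
  have h3 : (Mᵀ * endToEnd (diagonalParams U t)).trace = ∑ j, s j * t j ^ L := by
    rw [endToEnd_diagonalParams hL hU, ← Matrix.mul_assoc, trace_mul_comm, ← Matrix.mul_assoc,
      ← Matrix.mul_assoc]
    have : (U 0)ᵀ * Mᵀ * U (Fin.last L) = diagonal s := by
      rw [← diagonal_transpose s, ← hM]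
      simp only [transpose_mul, transpose_transpose, Matrix.mul_assoc]
    rw [this, diagonal_mul_diagonal, trace_diagonal]
  have h4 : frobeniusNorm (endToEnd (diagonalParams U t)) ^ 2 = ∑ j, t j ^ (2 * L) := by
    rw [endToEnd_diagonalParams hL hU, frobeniusNorm_isometry_conj_sq (hU _) (hU _)]
    exact Finset.sum_congr rfl fun j _ => by ring
  have h5 : ∀ i, frobeniusNorm (diagonalParams U t i) ^ 2 = ∑ j, t j ^ 2 :=
    fun i => frobeniusNorm_isometry_conj_sq (hU _) (hU _) t
  rw [neg_one_smul, ← sub_eq_add_neg] at h2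
  rw [loss, h2, h3, h4, frobeniusNorm_sq]
  simp only [h5, scalarLoss, Finset.sum_const, Finset.card_univ, Fintype.card_fin, nsmul_eq_mul,
    Finset.sum_add_distrib, ← Finset.mul_sum, mul_assoc]
  field_simp
  ring

theorem card_le_of_transpose_mul_self_eq_one {m : ℕ} {A : Matrix (Fin m) J ℝ} (hA : Aᵀ * A = 1) :
    Fintype.card J ≤ m := by
  have h := rank_mul_le_right Aᵀ A
  rw [hA, rank_one] at h
  simpa using h.trans (rank_le_card_height A)

theorem exists_transpose_mul_self_eq_one {m : ℕ} (h : Fintype.card J ≤ m) :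
    ∃ A : Matrix (Fin m) J ℝ, Aᵀ * A = 1 := by
  obtain ⟨f⟩ := Function.Embedding.nonempty_of_card_le (α := J) (β := Fin m) (by simpa using h)
  refine ⟨(1 : Matrix (Fin m) (Fin m) ℝ).submatrix id f, ?_⟩
  rw [transpose_submatrix, ← submatrix_mul _ _ _ _ _ Function.bijective_id, transpose_one,
    Matrix.mul_one, submatrix_one_embedding]

/-- The isometries `A` and `B` bound `Fintype.card J` by both outer widths, so every hidden layer is
wide enough for an isometry too. -/
theorem exists_isometries (hL : L ≠ 0) (hd : ∀ i : Fin (L + 1), min (d 0) (d (Fin.last L)) ≤ d i)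
    {A : Matrix (Fin (d 0)) J ℝ} {B : Matrix (Fin (d (Fin.last L))) J ℝ}
    (hA : Aᵀ * A = 1) (hB : Bᵀ * B = 1) :
    ∃ U : (k : Fin (L + 1)) → Matrix (Fin (d k)) J ℝ,
      (∀ k, (U k)ᵀ * U k = 1) ∧ U 0 = A ∧ U (Fin.last L) = B := by
  have hne : (0 : Fin (L + 1)) ≠ Fin.last L := by
    rw [Ne, Fin.ext_iff]; simpa using hL.symm
  choose U₀ hU₀ using fun k => exists_transpose_mul_self_eq_one (J := J)
    ((le_min (card_le_of_transpose_mul_self_eq_one hA)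
      (card_le_of_transpose_mul_self_eq_one hB)).trans (hd k))
  refine ⟨Function.update (Function.update U₀ 0 A) (Fin.last L) B, fun k => ?_, ?_, ?_⟩
  · rcases eq_or_ne k (Fin.last L) with rfl | hk
    · simpa using hB
    rw [Function.update_of_ne hk]
    rcases eq_or_ne k 0 with rfl | hk0
    · simpa using hA
    rw [Function.update_of_ne hk0]
    exact hU₀ k
  · rw [Function.update_of_ne hne, Function.update_self]
  · rw [Function.update_self]

/-- Any nonnegative choice of singular values along the right singular vectors of the target is
attained by a factorization with the corresponding scalar losses. -/
theorem exists_params_loss_eq (hL : L ≠ 0)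
    (hd : ∀ i : Fin (L + 1), min (d 0) (d (Fin.last L)) ≤ d i)
    (M : Matrix (Fin (d (Fin.last L))) (Fin (d 0)) ℝ) (lam : ℝ)
    {A : Matrix (Fin (d 0)) J ℝ} (hA : Aᵀ * A = 1) {s : J → ℝ} (hs : ∀ j, s j ≠ 0)
    (hMA : Mᵀ * M * A = A * diagonal (fun j => s j ^ 2)) (t : J → ℝ) :
    ∃ W : Params d, loss M lam W = (Mᵀ * M).trace + ∑ j, scalarLoss L lam (s j) (t j) := by
  have h1 : (M * A)ᵀ * (M * A) = diagonal (fun j => s j ^ 2) := by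
    rw [transpose_mul, Matrix.mul_assoc, ← Matrix.mul_assoc Mᵀ, hMA, ← Matrix.mul_assoc, hA,
      Matrix.one_mul]
  -- `M * A * diagonal (s⁻¹)` collects the left singular vectors; this is why `s` must not vanish.
  have h2 : (M * A * diagonal (fun j => (s j)⁻¹))ᵀ * (M * A) = diagonal s := by
    rw [transpose_mul, Matrix.mul_assoc, h1, diagonal_transpose, diagonal_mul_diagonal]
    congr 1; ext j
    have := hs j
    field_simp
  have h3 : (M * A * diagonal (fun j => (s j)⁻¹))ᵀ * (M * A * diagonal (fun j => (s j)⁻¹)) = 1 := by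
    rw [← Matrix.mul_assoc, h2, diagonal_mul_diagonal, ← diagonal_one]
    congr 1; ext j
    exact mul_inv_cancel₀ (hs j)
  obtain ⟨U, hU, h0, hlast⟩ := exists_isometries hL hd hA h3
  refine ⟨diagonalParams U t, loss_diagonalParams hL hU ?_ lam t⟩
  rw [h0, hlast, Matrix.mul_assoc, h2]

end Competitor

/-! ### Simultaneous diagonalization -/

theorem exists_orthonormal_diagonalization {n : ℕ} {A B : Matrix (Fin n) (Fin n) ℝ}
    (hA : Aᵀ = A) (hB : Bᵀ = B) (hAB : A * B = B * A) :
    ∃ (V : Matrix (Fin n) (Fin n) ℝ) (a b : Fin n → ℝ), Vᵀ * V = 1 ∧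
      A * V = V * diagonal a ∧ B * V = V * diagonal b := by
  have hA' : (toEuclideanLin A).IsSymmetric := isSymmetric_toEuclideanLin_iff.2 hA
  have hB' : (toEuclideanLin B).IsSymmetric := isSymmetric_toEuclideanLin_iff.2 hB
  have hcomm : Commute (toEuclideanLin A) (toEuclideanLin B) := by
    ext v
    simp [toEuclideanLin, hAB]
  set F : ℝ × ℝ → Submodule ℝ (EuclideanSpace ℝ (Fin n)) := fun i =>
    Module.End.eigenspace (toEuclideanLin A) i.2 ⊓ Module.End.eigenspace (toEuclideanLin B) i.1
  have hF : DirectSum.IsInternal F := hA'.directSum_isInternal_of_commute hB' hcomm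
  have hO : OrthogonalFamily ℝ (fun i => F i) fun i => (F i).subtypeₗᵢ :=
    hA'.orthogonalFamily_eigenspace_inf_eigenspace hB'
  -- The joint eigenspaces are indexed by all of `ℝ × ℝ`; a basis indexed by `Fin n` needs the
  -- finitely many nonzero ones.
  have hfin : {i | F i ≠ ⊥}.Finite :=
    WellFoundedGT.finite_ne_bot_of_iSupIndep hF.submodule_iSupIndep
  have : Fintype {i // F i ≠ ⊥} := hfin.fintype
  have hF' : DirectSum.IsInternal fun i : {i // F i ≠ ⊥} => F i :=
    DirectSum.isInternal_ne_bot_iff.2 hF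
  have hO' := hO.comp (γ := {i // F i ≠ ⊥}) Subtype.val_injective
  have hn : Module.finrank ℝ (EuclideanSpace ℝ (Fin n)) = n := by simp
  let v := hF'.subordinateOrthonormalBasis hn hO'
  let ind := fun j => (hF'.subordinateOrthonormalBasisIndex hn j hO').1
  have hv : ∀ j, v j ∈ F (ind j) := fun j =>
    hF'.subordinateOrthonormalBasis_subordinate hn j hO'
  refine ⟨Matrix.of fun i j => v j i, fun j => (ind j).2, fun j => (ind j).1, ?_, ?_, ?_⟩
  · ext i j
    have := orthonormal_iff_ite.1 v.orthonormal i j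
    simp only [PiLp.inner_apply, RCLike.inner_apply, conj_trivial] at this
    simp only [Matrix.mul_apply, transpose_apply, of_apply, one_apply, ← this]
    exact Finset.sum_congr rfl fun k _ => mul_comm _ _
  · ext i j
    have := congrArg (fun w => w i) (Module.End.mem_eigenspace_iff.1 (hv j).1)
    simpa [toEuclideanLin, mulVec, dotProduct, Matrix.mul_apply, diagonal_apply, mul_comm] using this
  · ext i j
    have := congrArg (fun w => w i) (Module.End.mem_eigenspace_iff.1 (hv j).2)
    simpa [toEuclideanLin, mulVec, dotProduct, Matrix.mul_apply, diagonal_apply, mul_comm] using this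

section Diagonalized

variable {n : ℕ} {V A : Matrix (Fin n) (Fin n) ℝ} {a : Fin n → ℝ}

theorem eq_conj_diagonal (hV : Vᵀ * V = 1) (h : A * V = V * diagonal a) :
    A = V * diagonal a * Vᵀ := by
  rw [← h, Matrix.mul_assoc, mul_eq_one_comm.1 hV, Matrix.mul_one]

theorem pow_mul_eq_mul_diagonal (h : A * V = V * diagonal a) (k : ℕ) :
    A ^ k * V = V * diagonal (fun j => a j ^ k) := by
  have hk : diagonal (fun j => a j ^ k) = diagonal a ^ k := by rw [diagonal_pow]; rfl
  rw [hk]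
  clear hk
  induction k with
  | zero => simp
  | succ k ih => rw [pow_succ, Matrix.mul_assoc, h, ← Matrix.mul_assoc, ih,
      Matrix.mul_assoc, ← pow_succ]

theorem trace_eq_sum_of_mul_eq (hV : Vᵀ * V = 1) (h : A * V = V * diagonal a) :
    A.trace = ∑ j, a j := by
  rw [eq_conj_diagonal hV h, trace_mul_comm, ← Matrix.mul_assoc, hV, Matrix.one_mul, trace_diagonal]

theorem transpose_mul_mul_eq_diagonal (hV : Vᵀ * V = 1) (h : A * V = V * diagonal a) :
    Vᵀ * A * V = diagonal a := by
  rw [Matrix.mul_assoc, h, ← Matrix.mul_assoc, hV, Matrix.one_mul]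

theorem nonneg_of_posSemidef (hA : A.PosSemidef) (hV : Vᵀ * V = 1) (h : A * V = V * diagonal a)
    (j : Fin n) : 0 ≤ a j := by
  have h1 : (Vᴴ * A * V).PosSemidef := hA.conjTranspose_mul_mul_same V
  rw [conjTranspose_eq_transpose_of_trivial, transpose_mul_mul_eq_diagonal hV h,
    posSemidef_diagonal_iff] at h1
  exact h1 j

theorem charpoly_roots_of_mul_eq (hV : Vᵀ * V = 1) (h : A * V = V * diagonal a) :
    A.charpoly.roots = Finset.univ.val.map a := by
  have h1 : A.charpoly = (diagonal a).charpoly := by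
    rw [eq_conj_diagonal hV h, charpoly_mul_comm, ← Matrix.mul_assoc, hV, Matrix.one_mul]
  rw [h1, charpoly_diagonal]
  exact Polynomial.roots_multiset_prod_X_sub_C (Finset.univ.val.map a) ▸ by
    rw [Multiset.map_map]; rfl

/-- In an eigenbasis of `P`, a nonzero entry `K i j` forces `p j ^ L = p i ^ L`, hence `p j = p i`
because the eigenvalues are nonnegative. -/
theorem mul_comm_of_mul_comm_pow {N P : Matrix (Fin n) (Fin n) ℝ} {L : ℕ} (hL : L ≠ 0)
    (hP : P.PosSemidef) (h : N * P ^ L = P ^ L * N) : N * P = P * N := by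
  have hPt : Pᵀ = P := hP.isHermitian
  obtain ⟨V, p, -, hV, hPV, -⟩ := exists_orthonormal_diagonalization hPt hPt rfl
  have hVu : V * Vᵀ = 1 := mul_eq_one_comm.1 hV
  have hp := nonneg_of_posSemidef hP hV hPV
  set K := Vᵀ * N * V with hK
  have hNK : N = V * K * Vᵀ := by
    rw [hK]
    simp only [Matrix.mul_assoc, hVu, Matrix.mul_one]
    rw [← Matrix.mul_assoc, hVu, Matrix.one_mul]
  have conj : ∀ D E : Matrix (Fin n) (Fin n) ℝ,
      V * D * Vᵀ * (V * E * Vᵀ) = V * (D * E) * Vᵀ := by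
    intro D E
    have : V * D * Vᵀ * (V * E * Vᵀ) = V * D * (Vᵀ * V) * E * Vᵀ := by
      simp only [Matrix.mul_assoc]
    rw [this, hV, Matrix.mul_one, Matrix.mul_assoc V D E]
  have h1 : K * diagonal (fun j => p j ^ L) = diagonal (fun j => p j ^ L) * K := by
    rw [hNK, eq_conj_diagonal hV (pow_mul_eq_mul_diagonal hPV L), conj, conj] at h
    have h2 := congrArg (fun Z => Vᵀ * Z * V) h
    simpa only [Matrix.mul_assoc, hV, Matrix.mul_one, ← Matrix.mul_assoc Vᵀ V, Matrix.one_mul]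
      using h2
  have h2 : K * diagonal p = diagonal p * K := by
    ext i j
    have h3 := congrFun (congrFun h1 i) j
    rw [mul_diagonal, diagonal_mul] at h3 ⊢
    rcases eq_or_ne (K i j) 0 with h0 | h0
    · simp [h0]
    · rw [mul_comm, mul_left_inj' h0, pow_left_inj₀ (hp j) (hp i) hL] at h3
      rw [h3, mul_comm]
  rw [hNK, eq_conj_diagonal hV hPV, conj, conj, h2]

end Diagonalized

/-! ### Singular values of the target and positivity of the threshold -/

theorem exists_singularValueVec_eq {m n : ℕ} (M : Matrix (Fin m) (Fin n) ℝ) {v : Fin n → ℝ}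
    (hv : v ≠ 0) {s : ℝ} (hs : 0 < s) (h : (Mᵀ * M) *ᵥ v = s ^ 2 • v) :
    ∃ i, singularValueVec M i = s := by
  set T := toEuclideanLin M
  have hT : LinearMap.adjoint T ∘ₗ T = toEuclideanLin (Mᵀ * M) := by
    rw [← toEuclideanLin_conjTranspose_eq_adjoint, conjTranspose_eq_transpose_of_trivial]
    ext w
    simp [T, toEuclideanLin]
  have hev : Module.End.HasEigenvalue (LinearMap.adjoint T ∘ₗ T) (s ^ 2) := by
    rw [hT]
    refine Module.End.hasEigenvalue_of_hasEigenvector (x := WithLp.toLp 2 v) ⟨?_, ?_⟩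
    · rw [Module.End.mem_eigenspace_iff]
      ext i
      simpa [toEuclideanLin] using congrFun h i
    · simpa using hv
  have hn : Module.finrank ℝ (EuclideanSpace ℝ (Fin n)) = n := by simp
  obtain ⟨i, hi⟩ := T.isSymmetric_adjoint_comp_self.exists_eigenvalues_eq hn hev
  have hsv : T.singularValues i = s := by
    have := T.sq_singularValues_fin hn i
    rw [show T.isSymmetric_adjoint_comp_self.eigenvalues hn i = s ^ 2 from hi] at this
    exact (pow_left_inj₀ (T.singularValues_nonneg i) hs.le two_ne_zero).1 this
  -- The index ranges over all `n` eigenvalues; positivity places it below the rank, hence below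
  -- `min m n`.
  have hlt : (i : ℕ) < Module.finrank ℝ T.range :=
    T.singularValues_pos_iff_lt_finrank_range.1 (hsv ▸ hs)
  have hle : Module.finrank ℝ T.range ≤ m := by
    simpa using Submodule.finrank_le T.range
  exact ⟨⟨i, lt_min (hlt.trans_le hle) i.2⟩, hsv⟩

theorem threshold_pos {L : ℕ} (hL : 2 ≤ L) {lam : ℝ} (hlam : 0 < lam) : 0 < threshold L lam := by
  rcases hL.eq_or_lt with rfl | h
  · norm_num [threshold]
    positivity
  · have h3 : (2 : ℝ) < L := by exact_mod_cast h
    have hq : (2 : ℝ) / L < 1 := by rw [div_lt_one (by linarith)]; exact h3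
    have h1 : (0 : ℝ) < 1 - 2 / L := by linarith
    have h2 : (0 : ℝ) < 1 - 2 / L / 2 := by
      have : (0 : ℝ) ≤ 2 / L := by positivity
      linarith
    simp only [threshold]
    positivity

/-! ### From the matrix problem to the scalar problem -/

variable {L : ℕ} {d : Fin (L + 1) → ℕ} {M : Matrix (Fin (d (Fin.last L))) (Fin (d 0)) ℝ} {lam : ℝ}
  {W : Params d}

/-- Simultaneous singular value decomposition of the target and of a global minimizer. -/
theorem exists_minimizer_diagonalization (hL : 0 < L) (hlam : 0 < lam) (hW : W ∈ minimizers M lam) :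
    ∃ (V : Matrix (Fin (d 0)) (Fin (d 0)) ℝ) (s t : Fin (d 0) → ℝ), Vᵀ * V = 1 ∧
      Mᵀ * M * V = V * diagonal (fun j => s j ^ 2) ∧
      balanceMatrix M lam W 0 * V = V * diagonal (fun j => t j ^ 2) ∧
      (∀ j, 0 ≤ s j) ∧ (∀ j, 0 ≤ t j) ∧
      (∀ j, s j * t j ^ L = lam / L * t j ^ 2 + t j ^ (2 * L)) := by
  have hLr : (0 : ℝ) < L := by exact_mod_cast hL
  have hc : lam / L ≠ 0 := by positivity
  set P := balanceMatrix M lam W 0 with hPdef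
  set N := Mᵀ * M with hN
  have hP : P.PosSemidef := balanceMatrix_posSemidef hc hW hL
  have hPt : Pᵀ = P := balanceMatrix_transpose hc hW hL
  have hNp : N.PosSemidef := posSemidef_conjTranspose_mul_self M
  have hNt : Nᵀ = N := hNp.isHermitian
  have hG : N * P ^ L = ((lam / L) • P + P ^ L) ^ 2 := gram_mul_balanceMatrix_pow hc hW hL
  have hcomm : N * P ^ L = P ^ L * N := by
    have h := congrArg transpose hG
    rw [transpose_mul, transpose_pow, transpose_pow, transpose_add, transpose_smul, transpose_pow,
      hPt, hNt] at h
    rw [h, hG]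
  obtain ⟨V, m, p, hV, hNV, hPV⟩ := exists_orthonormal_diagonalization hNt hPt
    (mul_comm_of_mul_comm_pow hL.ne' hP hcomm)
  have hm := nonneg_of_posSemidef hNp hV hNV
  have hp := nonneg_of_posSemidef hP hV hPV
  refine ⟨V, fun j => √(m j), fun j => √(p j), hV, ?_, ?_, fun j => Real.sqrt_nonneg _,
    fun j => Real.sqrt_nonneg _, fun j => ?_⟩
  · simpa only [Real.sq_sqrt (hm _)] using hNV
  · simpa only [Real.sq_sqrt (hp _)] using hPV
  · have hGV : ((lam / L) • P + P ^ L) * V = V * diagonal (fun j => lam / L * p j + p j ^ L) := by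
      rw [Matrix.add_mul, Matrix.smul_mul, hPV, pow_mul_eq_mul_diagonal hPV, ← Matrix.mul_smul,
        ← Matrix.mul_add, ← diagonal_smul, diagonal_add]
      rfl
    have h1 : N * P ^ L * V = V * diagonal (fun j => m j * p j ^ L) := by
      rw [Matrix.mul_assoc, pow_mul_eq_mul_diagonal hPV, ← Matrix.mul_assoc, hNV,
        Matrix.mul_assoc, diagonal_mul_diagonal]
    have h2 : diagonal (fun j => m j * p j ^ L)
        = diagonal (fun j => (lam / L * p j + p j ^ L) ^ 2) := by
      rw [← transpose_mul_mul_eq_diagonal hV h1, hG,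
        transpose_mul_mul_eq_diagonal hV (pow_mul_eq_mul_diagonal hGV 2)]
    have h3 : m j * p j ^ L = (lam / L * p j + p j ^ L) ^ 2 := congrFun (diagonal_injective h2) j
    have hpj := hp j
    have h4 : (√(m j) * √(p j) ^ L) ^ 2 = (lam / L * √(p j) ^ 2 + √(p j) ^ (2 * L)) ^ 2 := by
      rw [pow_mul √(p j) 2 L, Real.sq_sqrt hpj, ← h3, mul_pow, Real.sq_sqrt (hm j), ← pow_mul,
        mul_comm L, pow_mul, Real.sq_sqrt hpj]
    exact (pow_left_inj₀ (by positivity) (by positivity) two_ne_zero).1 h4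

theorem loss_minimizer_eq_sum (hL : 0 < L) (hlam : 0 < lam) (hW : W ∈ minimizers M lam)
    {V : Matrix (Fin (d 0)) (Fin (d 0)) ℝ} {s t : Fin (d 0) → ℝ} (hV : Vᵀ * V = 1)
    (hPV : balanceMatrix M lam W 0 * V = V * diagonal (fun j => t j ^ 2))
    (hst : ∀ j, s j * t j ^ L = lam / L * t j ^ 2 + t j ^ (2 * L)) :
    loss M lam W = (Mᵀ * M).trace + ∑ j, scalarLoss L lam (s j) (t j) := by
  have hLr : (0 : ℝ) < L := by exact_mod_cast hL
  rw [loss_minimizer (by positivity) hW hL, trace_add, trace_smul, trace_eq_sum_of_mul_eq hV hPV,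
    trace_eq_sum_of_mul_eq hV (pow_mul_eq_mul_diagonal hPV L)]
  simp only [scalarLoss, Finset.sum_add_distrib, neg_mul, Finset.sum_neg_distrib, mul_assoc, hst,
    ← Finset.mul_sum, smul_eq_mul, ← pow_mul]
  ring

/-- At a global minimizer each singular value solves the scalar problem. -/
theorem isScalarOptimum_of_minimizer (hL : 0 < L) (hlam : 0 < lam)
    (hd : ∀ i : Fin (L + 1), min (d 0) (d (Fin.last L)) ≤ d i) (hW : W ∈ minimizers M lam)
    {V : Matrix (Fin (d 0)) (Fin (d 0)) ℝ} {s t : Fin (d 0) → ℝ} (hV : Vᵀ * V = 1)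
    (hNV : Mᵀ * M * V = V * diagonal (fun j => s j ^ 2))
    (hPV : balanceMatrix M lam W 0 * V = V * diagonal (fun j => t j ^ 2))
    (ht : ∀ j, 0 ≤ t j) (hst : ∀ j, s j * t j ^ L = lam / L * t j ^ 2 + t j ^ (2 * L))
    (j : Fin (d 0)) : IsScalarOptimum L lam (s j) (t j) := by
  have hLr : (0 : ℝ) < L := by exact_mod_cast hL
  -- Directions with `s j = 0` contribute nothing, so competitors only need the remaining ones.
  have hzero : ∀ j, s j = 0 → t j = 0 := by
    intro j hj
    have h := hst j
    rw [hj, zero_mul] at h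
    have h1 : 0 ≤ t j ^ (2 * L) := pow_nonneg (ht j) _
    have h2 : 0 ≤ lam / L * t j ^ 2 := by positivity
    have h3 : lam / L * t j ^ 2 = 0 := by linarith
    have h4 : lam / L ≠ 0 := by positivity
    simpa [h4] using h3
  refine ⟨ht j, hst j, fun t' ht' => ?_⟩
  rcases eq_or_ne (s j) 0 with hj | hj
  · rw [hzero j hj, scalarLoss_zero hL.ne', hj, scalarLoss]
    have := pow_nonneg ht' (2 * L)
    have : 0 ≤ lam * t' ^ 2 := by positivity
    linarith
  -- Changing a single coordinate isolates the `j`-th scalar loss.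
  set u := Function.update t j t' with hu
  have huz : ∀ k, s k = 0 → u k = 0 := by
    intro k hk
    rw [hu, Function.update_of_ne (by rintro rfl; exact hj hk)]
    exact hzero k hk
  obtain ⟨W', hW'⟩ := exists_params_loss_eq (J := {k // s k ≠ 0}) hL.ne' hd M lam
    (A := V.submatrix id Subtype.val) (s := fun k => s k)
    (by rw [transpose_submatrix, ← submatrix_mul _ _ _ _ _ Function.bijective_id, hV,
          submatrix_one _ Subtype.val_injective])
    (fun k => k.2)
    (by
      ext i k
      have := congrFun (congrFun hNV i) k
      rw [mul_diagonal] at this ⊢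
      exact this) (fun k => u k)
  have h1 := hW W'
  have h2 : ∑ k : {k // s k ≠ 0}, scalarLoss L lam (s k) (u k)
      = ∑ k, scalarLoss L lam (s k) (u k) := by
    rw [← Finset.sum_subtype (Finset.univ.filter fun k => s k ≠ 0) (by simp)
      (fun k => scalarLoss L lam (s k) (u k))]
    refine Finset.sum_filter_of_ne fun k _ hk h0 => hk ?_
    rw [huz k h0, scalarLoss_zero hL.ne']
  rw [hW', loss_minimizer_eq_sum hL hlam hW hV hPV hst, h2, add_le_add_iff_left,
    ← Finset.add_sum_erase _ _ (Finset.mem_univ j),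
    ← Finset.add_sum_erase _ (fun k => scalarLoss L lam (s k) (u k)) (Finset.mem_univ j)] at h1
  have h3 : ∑ k ∈ Finset.univ.erase j, scalarLoss L lam (s k) (u k)
      = ∑ k ∈ Finset.univ.erase j, scalarLoss L lam (s k) (t k) :=
    Finset.sum_congr rfl fun k hk => by rw [hu, Function.update_of_ne (Finset.ne_of_mem_erase hk)]
  rw [h3, add_le_add_iff_right, hu, Function.update_self] at h1
  exact h1

open Classical in
/-- The optimum of the scalar problem, if there is one. -/
noncomputable def scalarOptimum (L : ℕ) (lam s : ℝ) : ℝ :=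
  if h : ∃ t, IsScalarOptimum L lam s t then h.choose else 0

theorem IsScalarOptimum.eq_scalarOptimum {s t : ℝ} (hL : 2 ≤ L) (hlam : 0 < lam)
    (hs : s ≠ threshold L lam) (h : IsScalarOptimum L lam s t) : t = scalarOptimum L lam s := by
  have hex : ∃ t, IsScalarOptimum L lam s t := ⟨t, h⟩
  rw [scalarOptimum, dif_pos hex]
  exact h.unique hL hlam hs hex.choose_spec

/-- The basis and the ordering of `s` depend on `W`; the multiset of roots of the characteristic
polynomial does not. -/
theorem layerNorm_minimizer_sq (hL : 2 ≤ L) (hlam : 0 < lam)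
    (hd : ∀ i : Fin (L + 1), min (d 0) (d (Fin.last L)) ≤ d i)
    (hM : M ∉ exceptionalSet L (d (Fin.last L)) (d 0) lam) (hW : W ∈ minimizers M lam)
    (i : Fin L) :
    layerNorm W i ^ 2
      = ((Mᵀ * M).charpoly.roots.map fun x => scalarOptimum L lam √x ^ 2).sum := by
  have hL0 : 0 < L := by omega
  have hLr : (0 : ℝ) < L := by exact_mod_cast hL0
  obtain ⟨V, s, t, hV, hNV, hPV, hs, ht, hst⟩ := exists_minimizer_diagonalization hL0 hlam hW
  have hne : ∀ j, s j ≠ threshold L lam := by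
    intro j hj
    -- Positivity excludes the surplus zero eigenvalues of `MᵀM`, which need not be singular values
    -- of `M` when `d 0` exceeds `d (Fin.last L)`.
    have hpos : 0 < s j := hj ▸ threshold_pos hL hlam
    refine hM ?_
    have hvj : (fun i => V i j) ≠ 0 := by
      intro h0
      have h1 := congrFun (congrFun hV j) j
      simp [Matrix.mul_apply, fun i => congrFun h0 i] at h1
    obtain ⟨i, hi⟩ := exists_singularValueVec_eq M hvj hpos (by
      ext i
      have h1 := congrFun (congrFun hNV i) j
      rw [mul_diagonal] at h1
      exact h1.trans (mul_comm _ _))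
    exact Set.mem_iUnion.2 ⟨i, hi.trans hj⟩
  rw [layerNorm, frobeniusNorm_layer_sq (by positivity) hW, trace_eq_sum_of_mul_eq hV hPV,
    charpoly_roots_of_mul_eq hV hNV, Multiset.map_map]
  refine Finset.sum_congr rfl fun j _ => ?_
  simp only [Function.comp_apply, Real.sqrt_sq (hs j)]
  rw [← (isScalarOptimum_of_minimizer hL0 hlam hd hW hV hNV hPV ht hst j).eq_scalarOptimum
    hL hlam (hne j)]

end DeepFactorization

theorem mainTheorem5 (L : ℕ) (hL : 2 ≤ L) (d : Fin (L + 1) → ℕ)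
    (hd : ∀ i : Fin (L + 1), min (d 0) (d (Fin.last L)) ≤ d i)
    (M : Matrix (Fin (d (Fin.last L))) (Fin (d 0)) ℝ) (lam : ℝ) (hlam : 0 < lam)
    (hM : M ∉ DeepFactorization.exceptionalSet L (d (Fin.last L)) (d 0) lam) :
    ∃ c : ℝ, ∀ W ∈ DeepFactorization.minimizers M lam, ∀ i : Fin L,
      DeepFactorization.layerNorm W i = c := by
  refine ⟨√((M.transpose * M).charpoly.roots.map
    fun x => DeepFactorization.scalarOptimum L lam √x ^ 2).sum, fun W hW i => ?_⟩
  rw [← DeepFactorization.layerNorm_minimizer_sq hL hlam hd hM hW i]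
  exact (Real.sqrt_sq (DeepFactorization.frobeniusNorm_nonneg (W i))).symm
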